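/- Let $\mathrm{PA}$ be first-order Peano arithmetic (language $0,S,+,\cdot,<$), and code a binary string $r$ of length $N$ by the number whose binary expansion is $1r$. For a number $N$, a rational $\delta>0$ and a formula $R(x)$ with no free variable other than $x$, let $C_{N,\delta,R}$ be the closed arithmetic formula saying that the number of strings $x$ of length $N$ with $\lnot R(x)$ does not exceed $\delta 2^N$ (that is, among any $\lfloor\delta 2^N\rfloor+1$ strings of length $N$ that falsify $R$, two coincide). A proof strategy $\pi$ with initial capital $\varepsilon\ge 0$ is a finite tree. Each vertex carries a set $\Gamma$ of accepted closed formulas and a remaining capital $\rho$; at the root $\Gamma$ is the set of axioms of $\mathrm{PA}$ and $\rho=\varepsilon$. At a vertex the strategy does one of the following: 1. it terminates (the vertex is a leaf); 2. it adds to $\Gamma$ a closed formula derivable from $\Gamma$ in first-order logic, leaving the capital unchanged; 3. it makes a random step: for some $N$, some rational $\delta$ with $0<\delta\le\rho$ and some $R(x)$ such that $C_{N,\delta,R}\in\Gamma$ (it has already been proved or accepted), a fair coin is tossed $N$ times, giving a string $r$ of length $N$; the formula $R(r)$ is added to $\Gamma$, the capital becomes $\rho-\delta$, and the strategy continues in a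 way that may depend on $r$. Let $F$ be a closed arithmetic formula. If the probability (over the coin tosses) that $F$ belongs to the set of accepted formulas when $\pi$ terminates is greater than $\varepsilon$, then $F$ is provable in $\mathrm{PA}$. -/

import Mathlib

noncomputable section

namespace RandomAxioms

open FirstOrder FirstOrder.Language

/-! ### The language of arithmetic `0, S, +, ·, <` -/

inductive ArithFunc : ℕ → Type
  | zero : ArithFunc 0
  | succ : ArithFunc 1
  | add : ArithFunc 2
  | mul : ArithFunc 2

inductive ArithRel : ℕ → Type
  | lt : ArithRel 2

abbrev arith : FirstOrder.Language.{0, 0} where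
  Functions := ArithFunc
  Relations := ArithRel

variable {α : Type}

def zero : arith.Term α := Constants.term (L := arith) ArithFunc.zero

def succ (t : arith.Term α) : arith.Term α := Functions.apply₁ (L := arith) ArithFunc.succ t

def add (s t : arith.Term α) : arith.Term α := Functions.apply₂ (L := arith) ArithFunc.add s t

def mul (s t : arith.Term α) : arith.Term α := Functions.apply₂ (L := arith) ArithFunc.mul s t

def lt (s t : arith.Term α) : arith.Formula α := Relations.formula₂ (L := arith) ArithRel.lt s t

/-- The numeral `S ⋯ S 0`. -/
def numeral : ℕ → arith.Term α
  | 0 => zero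
  | n + 1 => succ (numeral n)

/-- `∀ x₀ ⋯ ∀ xₙ₋₁, χ`, where the variables `Sum.inr i` of `χ` become the quantified `xᵢ`. -/
def univ {n : ℕ} (χ : arith.Formula (α ⊕ Fin n)) : arith.Formula α :=
  BoundedFormula.alls (n := n) (BoundedFormula.relabel id χ)

/-- Substitution of the terms `t i` for the variables `Sum.inr i`. -/
def inst {n : ℕ} (χ : arith.Formula (α ⊕ Fin n)) (t : Fin n → arith.Term α) : arith.Formula α :=
  BoundedFormula.subst χ (Sum.elim Term.var t)

/-! ### Provability -/

/-- Classical natural deduction with equality: `Provable Γ φ` says that there is a derivation of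
`φ` from assumptions in `Γ`. The type `α` is the set of free variables that may occur. In the
rule `univ_intro` the variables `Sum.inr i` are fresh, since the assumptions do not contain them.
The quantifier rules treat a block of `n` quantifiers at once; `n = 1` gives the usual rules. -/
inductive Provable : {α : Type} → Set (arith.Formula α) → arith.Formula α → Prop
  | assumption {α : Type} {Γ : Set (arith.Formula α)} {φ : arith.Formula α} :
      φ ∈ Γ → Provable Γ φ
  | imp_intro {α : Type} {Γ : Set (arith.Formula α)} {φ ψ : arith.Formula α} :
      Provable (insert φ Γ) ψ → Provable Γ (φ.imp ψ)
  | imp_elim {α : Type} {Γ : Set (arith.Formula α)} {φ ψ : arith.Formula α} :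
      Provable Γ (φ.imp ψ) → Provable Γ φ → Provable Γ ψ
  | by_contradiction {α : Type} {Γ : Set (arith.Formula α)} {φ : arith.Formula α} :
      Provable (insert φ.not Γ) ⊥ → Provable Γ φ
  | univ_intro {α : Type} {Γ : Set (arith.Formula α)} {n : ℕ} {χ : arith.Formula (α ⊕ Fin n)} :
      Provable ((fun φ : arith.Formula α => φ.subst fun a => Term.var (Sum.inl a)) '' Γ) χ →
        Provable Γ (univ χ)
  | univ_elim {α : Type} {Γ : Set (arith.Formula α)} {n : ℕ} {χ : arith.Formula (α ⊕ Fin n)}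
      (t : Fin n → arith.Term α) : Provable Γ (univ χ) → Provable Γ (inst χ t)
  | eq_refl {α : Type} {Γ : Set (arith.Formula α)} (t : arith.Term α) :
      Provable Γ (t.equal t)
  | eq_subst {α : Type} {Γ : Set (arith.Formula α)} {s t : arith.Term α}
      (χ : arith.Formula (α ⊕ Fin 1)) :
      Provable Γ (s.equal t) → Provable Γ (inst χ fun _ => s) → Provable Γ (inst χ fun _ => t)

/-! ### Peano arithmetic -/

/-- The variable `xᵢ` of a block of `n` quantified variables. -/
def x {n : ℕ} (i : Fin n) : arith.Term (α ⊕ Fin n) := Term.var (Sum.inr i)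

/-- The axioms of formal (first-order Peano) arithmetic. The formula `φ` of an induction axiom may contain `n`
parameters, which are universally quantified. -/
inductive IsAxiom : arith.Sentence → Prop
  | succ_ne_zero : IsAxiom (univ (n := 1) (Term.equal (succ (x 0)) zero).not)
  | succ_inj : IsAxiom (univ (n := 2)
      (((succ (x 0)).equal (succ (x 1))).imp ((x 0).equal (x 1))))
  | add_zero : IsAxiom (univ (n := 1) ((add (x 0) zero).equal (x 0)))
  | add_succ : IsAxiom (univ (n := 2) ((add (x 0) (succ (x 1))).equal (succ (add (x 0) (x 1)))))
  | mul_zero : IsAxiom (univ (n := 1) ((mul (x 0) zero).equal zero))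
  | mul_succ : IsAxiom (univ (n := 2) ((mul (x 0) (succ (x 1))).equal (add (mul (x 0) (x 1)) (x 0))))
  | not_lt_zero : IsAxiom (univ (n := 1) (lt (x 0) zero).not)
  | lt_succ : IsAxiom (univ (n := 2)
      ((lt (x 0) (succ (x 1))).iff (lt (x 0) (x 1) ⊔ (x 0).equal (x 1))))
  | induction {n : ℕ} (φ : arith.Formula ((Empty ⊕ Fin n) ⊕ Fin 1)) :
      IsAxiom (univ ((inst φ fun _ => zero).imp
        ((univ (φ.imp
          (φ.subst (Sum.elim (fun a => Term.var (Sum.inl a)) fun _ => succ (x 0))))).imp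
          (univ φ))))

def PA : arith.Theory := {φ | IsAxiom φ}

/-! ### Binary strings in arithmetic -/

/-- The code of a binary string of length `N`: the number whose binary expansion is a leading `1`
followed by the string. -/
def code {N : ℕ} (r : Fin N → Bool) : ℕ := 2 ^ N + Nat.ofBits r

/-- `t` is (the code of) a string of length `N`, i.e. `2 ^ N ≤ t < 2 ^ (N + 1)`. -/
def isString (N : ℕ) (t : arith.Term α) : arith.Formula α :=
  (lt t (numeral (2 ^ N))).not ⊓ lt t (numeral (2 ^ (N + 1)))

/-- `R(t)` for a property `R` with one free variable. -/
def apply (R : arith.Formula (Fin 1)) (t : arith.Term α) : arith.Formula α :=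
  BoundedFormula.subst R fun _ => t

/-- The closed formula "at most `k` strings of length `N` falsify `R`": among any `k + 1` strings
of length `N` that falsify `R`, two are equal. -/
def atMost (k N : ℕ) (R : arith.Formula (Fin 1)) : arith.Sentence :=
  univ (n := k + 1)
    ((Formula.iInf fun i : Fin (k + 1) => isString N (x i) ⊓ (apply R (x i)).not).imp
      (Formula.iSup fun p : {p : Fin (k + 1) × Fin (k + 1) // p.1 < p.2} =>
        (x p.1.1).equal (x p.1.2)))

/-- The closed formula "the number of strings of length `N` that falsify `R` does not exceed
`δ * 2 ^ N`". -/
def fewFalsify (δ : ℚ) (N : ℕ) (R : arith.Formula (Fin 1)) : arith.Sentence :=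
  atMost ⌊δ * 2 ^ N⌋₊ N R

/-! ### Proof strategies -/

/-- A proof strategy is a finite tree. At a vertex it terminates, or derives a formula from the
statements accepted so far, or makes a random step: `N` coin tosses give a string `r`, the formula
`R(r)` is accepted, `δ` is paid, and the strategy goes on in a way that depends on `r`. -/
inductive Strategy : Type
  | leaf : Strategy
  | derive (φ : arith.Sentence) (next : Strategy) : Strategy
  | random (N : ℕ) (δ : ℚ) (R : arith.Formula (Fin 1)) (next : (Fin N → Bool) → Strategy) :
      Strategy

/-- All steps are legal if `Γ` is the set of the statements accepted so far and `ρ` is the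
remaining capital. -/
def Strategy.Legal : Strategy → arith.Theory → ℝ → Prop
  | .leaf, _, _ => True
  | .derive φ next, Γ, ρ => Provable Γ φ ∧ next.Legal (insert φ Γ) ρ
  | .random N δ R next, Γ, ρ =>
      0 < δ ∧ (δ : ℝ) ≤ ρ ∧ fewFalsify δ N R ∈ Γ ∧
        ∀ r, (next r).Legal (insert (apply R (numeral (code r))) Γ) (ρ - δ)

/-- The distribution of the set of all accepted statements at the end, if it is `Γ` at the
beginning and the coin is fair. -/
def Strategy.run : Strategy → arith.Theory → PMF arith.Theory
  | .leaf, Γ => PMF.pure Γ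
  | .derive φ next, Γ => next.run (insert φ Γ)
  | .random N _ R next, Γ =>
      (PMF.uniformOfFintype (Fin N → Bool)).bind fun r =>
        (next r).run (insert (apply R (numeral (code r))) Γ)

/-- The probability that the strategy, starting from the axioms of arithmetic, gets `F`. -/
def Strategy.prob (π : Strategy) (F : arith.Sentence) : ENNReal :=
  (π.run PA).toOuterMeasure {Γ | F ∈ Γ}

end RandomAxioms

end

namespace RandomAxioms

open FirstOrder FirstOrder.Language

/-! ### Substitution -/

section Substitution

variable {α β γ : Type}

/-! The claim is strengthened to all theories `Γ` containing `PA` and all remaining capitals `ρ`: if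
`Γ` does not prove `F`, a legal strategy obtains `F` with probability at most `ρ`
(`Strategy.run_le_of_not_provable`, by induction on the tree). Only a random step matters. By
`exists_exceptional_finset`, at most `δ * 2 ^ N` strings `r` make `F` provable from `Γ` and `R(r)`;
they contribute at most `δ`, and every other branch at most `ρ - δ` by induction.

The exceptional strings lie in a maximal set `B` whose negations `¬R(r)` can be added to `Γ` without
proving `F`. It is small because `PA` proves distinct numerals unequal, so too many negations
contradict the accepted counting formula. Outside `B`, a case distinction on `R(r)` would prove `F`.
-/

theorem subst_relabel (t : arith.Term α) (g : α → β) (f : β → arith.Term γ) :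
    (t.relabel g).subst f = t.subst (f ∘ g) := by
  induction t with
  | var a => rfl
  | func F ts ih => simp only [Term.relabel, Term.subst, ih]

theorem relabel_subst (t : arith.Term α) (f : α → arith.Term β) (g : β → γ) :
    (t.subst f).relabel g = t.subst fun a => (f a).relabel g := by
  induction t with
  | var a => rfl
  | func F ts ih => simp only [Term.relabel, Term.subst, ih]

theorem term_subst_subst (t : arith.Term α) (f : α → arith.Term β) (g : β → arith.Term γ) :
    (t.subst f).subst g = t.subst fun a => (f a).subst g := by
  induction t with
  | var a => rfl
  | func F ts ih => simp only [Term.subst, ih]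

theorem formula_subst_subst (φ : arith.Formula α) (f : α → arith.Term β) (g : β → arith.Term γ) :
    BoundedFormula.subst (BoundedFormula.subst φ f) g =
      BoundedFormula.subst φ fun a => (f a).subst g := by
  unfold BoundedFormula.subst
  rw [BoundedFormula.mapTermRel_mapTermRel]
  congr 1
  funext n t
  simp only [Function.comp_apply, term_subst_subst]
  congr 1
  funext a
  rcases a with a | i
  · simp only [Sum.elim_inl, Function.comp_apply, subst_relabel, relabel_subst]
    rfl
  · rfl

@[simp]
theorem zero_subst (f : α → arith.Term β) : (zero : arith.Term α).subst f = zero := by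
  simp only [zero, Constants.term, Term.subst]
  exact congrArg _ (Subsingleton.elim _ _)

@[simp]
theorem succ_subst (t : arith.Term α) (f : α → arith.Term β) :
    (succ t).subst f = succ (t.subst f) := by
  simp only [succ, Functions.apply₁, Term.subst]
  congr 1
  funext i
  fin_cases i
  rfl

@[simp]
theorem numeral_subst (n : ℕ) (f : α → arith.Term β) :
    (numeral n : arith.Term α).subst f = numeral n := by
  induction n with
  | zero => exact zero_subst f
  | succ n ih => simp only [numeral, succ_subst, ih]

variable {n : ℕ} (t : Fin n → arith.Term α)

@[simp]
theorem x_subst (i : Fin n) : (x i).subst (Sum.elim Term.var t) = t i := rfl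

theorem inst_imp (φ ψ : arith.Formula (α ⊕ Fin n)) :
    inst (φ.imp ψ) t = (inst φ t).imp (inst ψ t) := rfl

theorem inst_not (φ : arith.Formula (α ⊕ Fin n)) : inst φ.not t = (inst φ t).not := rfl

theorem inst_inf (φ ψ : arith.Formula (α ⊕ Fin n)) :
    inst (φ ⊓ ψ) t = inst φ t ⊓ inst ψ t := rfl

theorem inst_sup (φ ψ : arith.Formula (α ⊕ Fin n)) :
    inst (φ ⊔ ψ) t = inst φ t ⊔ inst ψ t := rfl

theorem inst_iff (φ ψ : arith.Formula (α ⊕ Fin n)) :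
    inst (φ.iff ψ) t = (inst φ t).iff (inst ψ t) := rfl

/-- Atomic formulas store terms over variables extended by an empty block `Fin 0` of bound ones;
substitution commutes with this embedding. -/
theorem relabel_inl_subst (s : arith.Term (α ⊕ Fin n)) :
    (s.relabel (Sum.inl : _ → (α ⊕ Fin n) ⊕ Fin 0)).subst
      (Sum.elim (Term.relabel Sum.inl ∘ Sum.elim Term.var t) (Term.var ∘ Sum.inr)) =
    (s.subst (Sum.elim Term.var t)).relabel Sum.inl := by
  rw [subst_relabel, relabel_subst]
  rfl

theorem inst_equal (s u : arith.Term (α ⊕ Fin n)) :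
    inst (s.equal u) t =
      (s.subst (Sum.elim Term.var t)).equal (u.subst (Sum.elim Term.var t)) :=
  congrArg₂ BoundedFormula.equal (relabel_inl_subst t s) (relabel_inl_subst t u)

theorem inst_lt (s u : arith.Term (α ⊕ Fin n)) :
    inst (lt s u) t = lt (s.subst (Sum.elim Term.var t)) (u.subst (Sum.elim Term.var t)) := by
  refine congrArg (BoundedFormula.rel (L := arith) ArithRel.lt) ?_
  funext i
  fin_cases i
  · exact relabel_inl_subst t s
  · exact relabel_inl_subst t u

theorem inst_isString (N : ℕ) (s : arith.Term (α ⊕ Fin n)) :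
    inst (isString N s) t = isString N (s.subst (Sum.elim Term.var t)) := by
  simp only [isString, inst_inf, inst_not, inst_lt, numeral_subst]

theorem inst_apply (R : arith.Formula (Fin 1)) (s : arith.Term (α ⊕ Fin n)) :
    inst (apply R s) t = apply R (s.subst (Sum.elim Term.var t)) :=
  formula_subst_subst R _ _

theorem inst_iInf {ι : Type} [Finite ι] (f : ι → arith.Formula (α ⊕ Fin n)) :
    inst (Formula.iInf f) t = Formula.iInf fun i => inst (f i) t := by
  simp only [Formula.iInf, BoundedFormula.iInf]
  generalize Finset.toList _ = l
  induction l with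
  | nil => rfl
  | cons i l ih => exact congrArg (inst (f i) t ⊓ ·) ih

theorem inst_iSup {ι : Type} [Finite ι] (f : ι → arith.Formula (α ⊕ Fin n)) :
    inst (Formula.iSup f) t = Formula.iSup fun i => inst (f i) t := by
  simp only [Formula.iSup, BoundedFormula.iSup]
  generalize Finset.toList _ = l
  induction l with
  | nil => rfl
  | cons i l ih => exact congrArg (inst (f i) t ⊔ ·) ih

end Substitution

/-! ### Derived rules -/

namespace Provable

variable {α : Type} {Γ Δ : Set (arith.Formula α)} {φ ψ χ : arith.Formula α}

theorem mono (h : Provable Γ φ) (hΓ : Γ ⊆ Δ) : Provable Δ φ := by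
  induction h with
  | assumption h => exact assumption (hΓ h)
  | imp_intro _ ih => exact imp_intro (ih (Set.insert_subset_insert hΓ))
  | imp_elim _ _ ih₁ ih₂ => exact imp_elim (ih₁ hΓ) (ih₂ hΓ)
  | by_contradiction _ ih => exact by_contradiction (ih (Set.insert_subset_insert hΓ))
  | univ_intro _ ih => exact univ_intro (ih (Set.image_mono hΓ))
  | univ_elim t _ ih => exact univ_elim t (ih hΓ)
  | eq_refl t => exact eq_refl t
  | eq_subst χ _ _ ih₁ ih₂ => exact eq_subst χ (ih₁ hΓ) (ih₂ hΓ)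

theorem weaken (h : Provable Γ φ) : Provable (insert ψ Γ) φ := h.mono (Set.subset_insert _ _)

theorem head : Provable (insert φ Γ) φ := assumption (Set.mem_insert _ _)

theorem not_elim (h : Provable Γ φ.not) (h' : Provable Γ φ) : Provable Γ ⊥ := imp_elim h h'

theorem exfalso (h : Provable Γ ⊥) : Provable Γ φ := by_contradiction h.weaken

theorem cut (h : Provable Γ φ) (h' : Provable (insert φ Γ) ψ) : Provable Γ ψ :=
  imp_elim (imp_intro h') h

theorem cases_on (h : Provable (insert φ Γ) ψ) (h' : Provable (insert φ.not Γ) ψ) :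
    Provable Γ ψ := by
  have hn : Provable (insert ψ.not Γ) φ.not :=
    imp_intro (not_elim head.weaken (h.mono (Set.insert_subset_insert (Set.subset_insert _ _))))
  exact by_contradiction (not_elim head
    (cut hn (h'.mono (Set.insert_subset_insert (Set.subset_insert _ _)))))

/-- The rules for `⊓` and `⊔` rest on their definitions: `φ ⊓ ψ` is `¬(φ → ¬ψ)` and `φ ⊔ ψ` is `¬φ →
ψ`. -/
theorem and_intro (h : Provable Γ φ) (h' : Provable Γ ψ) : Provable Γ (φ ⊓ ψ) :=
  imp_intro (not_elim (imp_elim head h.weaken) h'.weaken)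

theorem and_left (h : Provable Γ (φ ⊓ ψ)) : Provable Γ φ :=
  by_contradiction (imp_elim h.weaken (imp_intro (exfalso (not_elim head.weaken head))))

theorem and_right (h : Provable Γ (φ ⊓ ψ)) : Provable Γ ψ :=
  by_contradiction (imp_elim h.weaken (imp_intro head.weaken))

theorem or_inl (h : Provable Γ φ) : Provable Γ (φ ⊔ ψ) :=
  imp_intro (exfalso (not_elim head h.weaken))

theorem or_inr (h : Provable Γ ψ) : Provable Γ (φ ⊔ ψ) := imp_intro h.weaken

theorem not_or (h : Provable Γ φ.not) (h' : Provable Γ ψ.not) : Provable Γ (φ ⊔ ψ).not :=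
  imp_intro (not_elim h'.weaken (imp_elim head h.weaken))

theorem mt (h : Provable Γ (φ.imp ψ)) (h' : Provable Γ ψ.not) : Provable Γ φ.not :=
  imp_intro (not_elim h'.weaken (imp_elim h.weaken head))

theorem iInf_intro {ι : Type} [Finite ι] {f : ι → arith.Formula α} (h : ∀ i, Provable Γ (f i)) :
    Provable Γ (Formula.iInf f) := by
  simp only [Formula.iInf, BoundedFormula.iInf]
  generalize Finset.toList _ = l
  induction l with
  | nil => exact imp_intro head
  | cons i l ih => exact and_intro (h i) ih

theorem not_iSup {ι : Type} [Finite ι] {f : ι → arith.Formula α}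
    (h : ∀ i, Provable Γ (f i).not) : Provable Γ (Formula.iSup f).not := by
  simp only [Formula.iSup, BoundedFormula.iSup]
  generalize Finset.toList _ = l
  induction l with
  | nil => exact imp_intro head
  | cons i l ih => exact not_or (h i) ih

end Provable

/-! ### Numerals in arithmetic -/

section Numerals

open Provable

variable {Γ : arith.Theory}

theorem provable_succ_ne_zero (hΓ : PA ⊆ Γ) (s : arith.Term Empty) :
    Provable Γ ((succ s).equal zero).not := by
  have h := univ_elim (fun _ => s) (assumption (hΓ IsAxiom.succ_ne_zero))
  simpa only [inst_not, inst_equal, succ_subst, x_subst, zero_subst] using h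

theorem provable_succ_inj (hΓ : PA ⊆ Γ) (s t : arith.Term Empty) :
    Provable Γ (((succ s).equal (succ t)).imp (s.equal t)) := by
  have h := univ_elim ![s, t] (assumption (hΓ IsAxiom.succ_inj))
  simp only [inst_imp, inst_equal, succ_subst, x_subst] at h
  exact h

theorem provable_not_lt_zero (hΓ : PA ⊆ Γ) (s : arith.Term Empty) :
    Provable Γ (lt s zero).not := by
  have h := univ_elim (fun _ => s) (assumption (hΓ IsAxiom.not_lt_zero))
  simpa only [inst_not, inst_lt, x_subst, zero_subst] using h

theorem provable_lt_succ (hΓ : PA ⊆ Γ) (s t : arith.Term Empty) :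
    Provable Γ ((lt s (succ t)).iff (lt s t ⊔ s.equal t)) := by
  have h := univ_elim ![s, t] (assumption (hΓ IsAxiom.lt_succ))
  simp only [inst_iff, inst_sup, inst_equal, inst_lt, succ_subst, x_subst] at h
  exact h

theorem provable_equal_symm {s t : arith.Term Empty} (h : Provable Γ (s.equal t)) :
    Provable Γ (t.equal s) := by
  -- Leibniz's rule for the formula `x = s`, with `s` held fixed: it carries `s = s` to `t = s`.
  have h' := eq_subst (Γ := Γ) (s := s) (t := t)
    ((x 0).equal (s.relabel Sum.inl) : arith.Formula (Empty ⊕ Fin 1)) h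
  have hs : ∀ f : Fin 1 → arith.Term Empty,
      (s.relabel (Sum.inl : _ → Empty ⊕ Fin 1)).subst (Sum.elim Term.var f) = s := by
    intro f
    rw [subst_relabel]
    clear h h'
    induction s with
    | var a => rfl
    | func F ts ih => simp only [Term.subst, ih]
  simp only [inst_equal, hs, x_subst] at h'
  exact h' (eq_refl s)

theorem provable_numeral_ne (hΓ : PA ⊆ Γ) {m n : ℕ} (h : m ≠ n) :
    Provable Γ ((numeral m).equal (numeral n)).not := by
  induction m generalizing n with
  | zero =>
    cases n with
    | zero => exact absurd rfl h
    | succ n =>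
      exact imp_intro (not_elim (provable_succ_ne_zero hΓ (numeral n)).weaken
        (provable_equal_symm head))
  | succ m ih =>
    cases n with
    | zero => exact provable_succ_ne_zero hΓ (numeral m)
    | succ n => exact mt (provable_succ_inj hΓ _ _) (ih (by omega))

theorem provable_numeral_lt (hΓ : PA ⊆ Γ) {m n : ℕ} (h : m < n) :
    Provable Γ (lt (numeral m) (numeral n)) := by
  induction n with
  | zero => exact absurd h (Nat.not_lt_zero m)
  | succ n ih =>
    refine imp_elim (and_right (provable_lt_succ hΓ (numeral m) (numeral n))) ?_
    rcases Nat.lt_succ_iff_lt_or_eq.mp h with h | rfl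
    · exact or_inl (ih h)
    · exact or_inr (eq_refl _)

theorem provable_numeral_not_lt (hΓ : PA ⊆ Γ) {m n : ℕ} (h : n ≤ m) :
    Provable Γ (lt (numeral m) (numeral n)).not := by
  induction n with
  | zero => exact provable_not_lt_zero hΓ _
  | succ n ih =>
    exact mt (and_left (provable_lt_succ hΓ (numeral m) (numeral n)))
      (not_or (ih (by omega)) (provable_numeral_ne hΓ (by omega)))

theorem provable_isString_code (hΓ : PA ⊆ Γ) {N : ℕ} (r : Fin N → Bool) :
    Provable Γ (isString N (numeral (code r))) := by
  have h := Nat.ofBits_lt_two_pow r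
  refine and_intro (provable_numeral_not_lt hΓ (Nat.le_add_right _ _))
    (provable_numeral_lt hΓ ?_)
  rw [code, pow_succ]
  omega

theorem code_injective (N : ℕ) : Function.Injective (code : (Fin N → Bool) → ℕ) := by
  intro r s h
  have h' : Nat.ofBits r = Nat.ofBits s := Nat.add_left_cancel h
  funext i
  rw [← Nat.testBit_ofBits_lt r i i.2, h', Nat.testBit_ofBits_lt s i i.2]

/-- A theory that accepts `atMost k N R` and refutes `R` at more than `k` strings of length `N` is
inconsistent. -/
theorem provable_falsum_of_atMost (hΓ : PA ⊆ Γ) {k N : ℕ} {R : arith.Formula (Fin 1)}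
    (hC : Provable Γ (atMost k N R)) {B : Finset (Fin N → Bool)} (hk : k < B.card)
    (hB : ∀ r ∈ B, Provable Γ (apply R (numeral (code r))).not) : Provable Γ ⊥ := by
  -- These `k + 1` distinct strings instantiate the quantifier block of `atMost k N R`.
  obtain ⟨e⟩ : Nonempty (Fin (k + 1) ↪ B) := by
    rw [Function.Embedding.nonempty_iff_card_le]
    simpa using hk
  have h := univ_elim (fun i => numeral (code (e i).1)) hC
  rw [inst_imp, inst_iInf, inst_iSup] at h
  simp only [inst_inf, inst_not, inst_isString, inst_apply, inst_equal, x_subst] at h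
  refine not_elim (not_iSup fun p => ?_) (imp_elim h (iInf_intro fun i => ?_))
  · refine provable_numeral_ne hΓ fun hp => p.2.ne ?_
    exact e.injective (Subtype.ext (code_injective N hp))
  · exact and_intro (provable_isString_code hΓ _) (hB _ (e i).2)

end Numerals

/-! ### Strategies -/

/-- If `Γ` does not prove `F` and accepts `atMost k N R`, then at most `k` of the formulas `R(r)`
make `F` provable when added to `Γ`. -/
theorem exists_exceptional_finset {Γ : arith.Theory} (hΓ : PA ⊆ Γ) {k N : ℕ}
    {R : arith.Formula (Fin 1)} {F : arith.Sentence} (hC : Provable Γ (atMost k N R))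
    (hF : ¬ Provable Γ F) :
    ∃ B : Finset (Fin N → Bool), B.card ≤ k ∧
      ∀ r ∉ B, ¬ Provable (insert (apply R (numeral (code r))) Γ) F := by
  classical
  let refuted (B : Finset (Fin N → Bool)) : arith.Theory :=
    Γ ∪ (fun r => (apply R (numeral (code r))).not) '' (B : Set (Fin N → Bool))
  -- A maximal set exists because there are finitely many sets of strings and `∅` qualifies by `hF`.
  obtain ⟨B, hB⟩ := (Set.toFinite {B | ¬ Provable (refuted B) F}).exists_maximal
    ⟨∅, by simpa [refuted] using hF⟩
  refine ⟨B, ?_, fun r hr h => ?_⟩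
  · by_contra! hk
    refine hB.prop (Provable.exfalso ?_)
    refine provable_falsum_of_atMost (hΓ.trans Set.subset_union_left)
      (hC.mono Set.subset_union_left) hk fun r hr => ?_
    exact .assumption (Or.inr ⟨r, hr, rfl⟩)
  -- By maximality `¬R(r)` also yields `F`, so `F` follows whichever way `R(r)` is decided.
  · have h' : Provable (refuted (insert r B)) F := by
      by_contra hn
      exact hr (hB.le_of_ge hn (Finset.subset_insert _ _) (Finset.mem_insert_self r B))
    refine hB.prop (Provable.cases_on
      (h.mono (Set.insert_subset_insert Set.subset_union_left)) (h'.mono ?_))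
    simp only [refuted, Finset.coe_insert, Set.image_insert_eq, Set.union_insert]
    exact subset_rfl

/-- If a random string can be exceptional in at most `δ * 2 ^ N` cases and an event has
probability at most `c` otherwise, then its total probability is at most `δ + c`. -/
theorem sum_uniform_le {N : ℕ} {δ : ℚ} (hδ : 0 < δ) {B : Finset (Fin N → Bool)}
    (hB : B.card ≤ ⌊δ * 2 ^ N⌋₊) {p : (Fin N → Bool) → ENNReal} {c : ENNReal}
    (h₁ : ∀ r, p r ≤ 1) (hc : ∀ r ∉ B, p r ≤ c) :
    ∑' r, PMF.uniformOfFintype (Fin N → Bool) r * p r ≤ ENNReal.ofReal δ + c := by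
  classical
  -- One pointwise bound avoids splitting the sum; its overcount on `B` is harmless.
  have hp : ∀ r, p r ≤ (if r ∈ B then 1 else 0) + c := by
    intro r
    by_cases hr : r ∈ B
    · simpa [hr] using (h₁ r).trans le_self_add
    · simpa [hr] using hc r hr
  have hcard : (B.card : ENNReal) ≤ ENNReal.ofReal δ * 2 ^ N := by
    have h : (B.card : ℚ) ≤ δ * 2 ^ N :=
      (Nat.le_floor_iff (by positivity)).mp hB
    have h' : (B.card : ℝ) ≤ δ * 2 ^ N := by exact_mod_cast h
    calc (B.card : ENNReal) = ENNReal.ofReal B.card := (ENNReal.ofReal_natCast _).symm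
      _ ≤ ENNReal.ofReal (δ * 2 ^ N) := ENNReal.ofReal_le_ofReal h'
      _ = ENNReal.ofReal δ * 2 ^ N := by
        rw [ENNReal.ofReal_mul (by exact_mod_cast hδ.le), ENNReal.ofReal_pow (by norm_num),
          ENNReal.ofReal_ofNat]
  have h0 : (2 ^ N : ENNReal) ≠ 0 := pow_ne_zero _ two_ne_zero
  have ht : (2 ^ N : ENNReal) ≠ ⊤ := ENNReal.pow_ne_top ENNReal.ofNat_ne_top
  rw [tsum_fintype]
  simp only [PMF.uniformOfFintype_apply, Fintype.card_pi, Fintype.card_bool, Finset.prod_const,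
    Finset.card_univ, Fintype.card_fin, Nat.cast_pow, Nat.cast_ofNat]
  rw [← Finset.mul_sum]
  calc (2 ^ N : ENNReal)⁻¹ * ∑ r, p r
      ≤ (2 ^ N : ENNReal)⁻¹ * ∑ r : Fin N → Bool, ((if r ∈ B then 1 else 0) + c) := by
        gcongr with r
        exact hp r
    _ = (2 ^ N : ENNReal)⁻¹ * (B.card + 2 ^ N * c) := by
        simp [Finset.sum_add_distrib]
    _ ≤ (2 ^ N : ENNReal)⁻¹ * (ENNReal.ofReal δ * 2 ^ N + 2 ^ N * c) := by gcongr
    _ = (2 ^ N : ENNReal)⁻¹ * 2 ^ N * (ENNReal.ofReal δ + c) := by ring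
    _ = ENNReal.ofReal δ + c := by rw [ENNReal.inv_mul_cancel h0 ht, one_mul]

theorem toOuterMeasure_le_one {β : Type} (p : PMF β) (s : Set β) : p.toOuterMeasure s ≤ 1 := by
  rw [PMF.toOuterMeasure_apply, ← p.tsum_coe]
  exact ENNReal.tsum_le_tsum fun a => Set.indicator_le_self s p a

/-- A formula that is not provable from the statements accepted so far is obtained with
probability at most the remaining capital. -/
theorem Strategy.run_le_of_not_provable (π : Strategy) {Γ : arith.Theory} {ρ : ℝ}
    {F : arith.Sentence} (hΓ : PA ⊆ Γ) (hπ : π.Legal Γ ρ) (hF : ¬ Provable Γ F) :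
    (π.run Γ).toOuterMeasure {Δ | F ∈ Δ} ≤ ENNReal.ofReal ρ := by
  -- Both the theory and the capital change along a branch.
  induction π generalizing Γ ρ with
  | leaf =>
    have h : F ∉ Γ := fun h => hF (.assumption h)
    simp [Strategy.run, h]
  | derive φ next ih =>
    -- By cut, adding a derivable formula does not make `F` provable.
    exact ih (hΓ.trans (Set.subset_insert _ _)) hπ.2 fun h => hF (.cut hπ.1 h)
  | random N δ R next ih =>
    obtain ⟨hδ, hδρ, hC, hnext⟩ := hπ
    obtain ⟨B, hB, hBF⟩ := exists_exceptional_finset hΓ (.assumption hC) hF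
    -- `ENNReal.ofReal` truncates at zero, so this splitting needs the legality condition `δ ≤ ρ`.
    have hρ : ENNReal.ofReal ρ = ENNReal.ofReal δ + ENNReal.ofReal (ρ - δ) := by
      rw [← ENNReal.ofReal_add (by exact_mod_cast hδ.le) (sub_nonneg.mpr hδρ),
        add_sub_cancel]
    rw [Strategy.run, PMF.toOuterMeasure_bind_apply, hρ]
    exact sum_uniform_le hδ hB (fun r => toOuterMeasure_le_one _ _) fun r hr =>
      ih r (hΓ.trans (Set.subset_insert _ _)) (hnext r) (hBF r hr)

end RandomAxioms

theorem proposition2 (ε : ℝ) (hε : 0 ≤ ε) (π : RandomAxioms.Strategy)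
    (hπ : π.Legal RandomAxioms.PA ε) (F : RandomAxioms.arith.Sentence)
    (hF : ENNReal.ofReal ε < π.prob F) :
    RandomAxioms.Provable RandomAxioms.PA F := by
  by_contra h
  exact hF.not_ge (π.run_le_of_not_provable subset_rfl hπ h)
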